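/- Let $\lambda_i>0$ for $i\ge 0$, $\mu_i>0$ for $i\ge 1$ and $\mu_0\ge 0$. Let $\mathcal X=\{X(t),\,t\ge 0\}$ be a birth-death process on $S=\{0,1,2,\dots\}$ with birth rates $\lambda_i$ and death rates $\mu_i$, that is, a right-continuous continuous-time Markov chain with $q$-matrix $q_{i,i+1}=\lambda_i$, $q_{i+1,i}=\mu_{i+1}$, $q_{ii}=-(\lambda_i+\mu_i)$, $q_{ij}=0$ for $|i-j|>1$, whose transition probabilities $P_{ij}(t)=\mathbb P(X(t)=j\mid X(0)=i)$, $i,j\in S$, satisfy both the backward and the forward Kolmogorov equations; the process may leave $S$ from state $0$, at rate $\mu_0$, to an absorbing state $-1$, or by explosion to an absorbing state $\infty$. Let $T_{ij}$ be the (possibly infinite) first hitting time of state $j$ when the process starts in state $i\ne j$. Put $\pi_0=1$, $\pi_n=\dfrac{\lambda_0\lambda_1\cdots\lambda_{n-1}}{\mu_1\mu_2\cdots\mu_n}$ for $n\ge 1$, and, for $0\le n\le\infty$, $K_n=\sum_{i=0}^n\pi_i$ and $L_n=\sum_{i=0}^n(\lambda_i\pi_i)^{-1}$ (where $K_\infty$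 and $L_\infty$ may be infinite), and $$C=\sum_{n=0}^\infty(\lambda_n\pi_n)^{-1}K_n,\qquad D=\sum_{n=0}^\infty(\lambda_n\pi_n)^{-1}(K_\infty-K_n).$$ Then, for every $n\ge 1$, $$\mathbb P(T_{0n}<\infty)=\frac1{1+\mu_0L_{n-1}},$$ and, if $C+D=\infty$, also $$\mathbb P(T_{n0}<\infty)=1-\frac{L_{n-1}}{L_\infty},$$ where the quotient is $0$ if $L_\infty=\infty$. -/

import Mathlib

open MeasureTheory
open scoped NNReal ENNReal Topology

namespace BirthDeath

/-- The extended state space `{-1} ∪ {0, 1, 2, …} ∪ {∞}` of a birth-death process: `⊥` is the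
absorbing state `-1`, entered from state `0` when `μ₀ > 0`, and `⊤` is the absorbing state `∞`,
entered by explosion. Its order topology makes `⊥` and every natural number isolated, and the
natural numbers converge to `⊤`. -/
abbrev State : Type := WithBot ℕ∞

/-- The natural number `i` as a state. -/
def st (i : ℕ) : State := ((i : ℕ∞) : WithBot ℕ∞)

/-- The entries of the `q`-matrix on `S = {0, 1, 2, …}` with birth rates `lam` and death rates
`mu`. -/
def q (lam mu : ℕ → ℝ) (i j : ℕ) : ℝ :=
  if j = i + 1 then lam i
  else if i = j + 1 then mu i
  else if i = j then -(lam i + mu i)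
  else 0

/-- `P t x y`, for `t ≥ 0`, are the transition probabilities of a birth-death process with birth
rates `lam` and death rates `mu`: a stochastic transition function on the extended state space for
which `-1` and `∞` are absorbing, whose restriction to `S` satisfies the backward and the forward
Kolmogorov equations, and for which the state `-1` is entered from state `0` at rate `mu 0`. -/
structure IsTransitionFunction (lam mu : ℕ → ℝ) (P : ℝ → State → State → ℝ) : Prop where
  nonneg : ∀ t, 0 ≤ t → ∀ x y, 0 ≤ P t x y
  hasSum_one : ∀ t, 0 ≤ t → ∀ x, HasSum (fun y => P t x y) 1
  zero : ∀ x y, P 0 x y = if x = y then 1 else 0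
  chapman_kolmogorov : ∀ s t, 0 ≤ s → 0 ≤ t → ∀ x y,
    HasSum (fun z => P s x z * P t z y) (P (s + t) x y)
  absorbing_bot : ∀ t, 0 ≤ t → P t ⊥ ⊥ = 1
  absorbing_top : ∀ t, 0 ≤ t → P t ⊤ ⊤ = 1
  /-- `P'ᵢⱼ = ∑ₖ qᵢₖ Pₖⱼ`; the terms with `k > i + 1` vanish. -/
  backward : ∀ t, 0 ≤ t → ∀ i j : ℕ,
    HasDerivWithinAt (fun u => P u (st i) (st j))
      (∑ k ∈ Finset.range (i + 2), q lam mu i k * P t (st k) (st j)) (Set.Ici 0) t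
  /-- `P'ᵢⱼ = ∑ₖ Pᵢₖ qₖⱼ`; the terms with `k > j + 1` vanish. -/
  forward : ∀ t, 0 ≤ t → ∀ i j : ℕ,
    HasDerivWithinAt (fun u => P u (st i) (st j))
      (∑ k ∈ Finset.range (j + 2), P t (st i) (st k) * q lam mu k j) (Set.Ici 0) t
  evanescence : ∀ t, 0 ≤ t → ∀ i : ℕ,
    HasDerivWithinAt (fun u => P u (st i) ⊥) (P t (st i) (st 0) * mu 0) (Set.Ici 0) t

/-- Under the probability measure `Pr`, `X` is a continuous-time Markov chain with right-continuous
paths, transition function `P` and initial state `x`. -/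
structure IsMarkovChainFrom {Ω : Type*} [MeasurableSpace Ω] (P : ℝ → State → State → ℝ)
    (x : State) (X : ℝ≥0 → Ω → State) (Pr : Measure Ω) : Prop where
  isProbabilityMeasure : IsProbabilityMeasure Pr
  measurable : ∀ t y, MeasurableSet {ω | X t ω = y}
  rightContinuous : ∀ ω t, ContinuousWithinAt (fun u => X u ω) (Set.Ici t) t
  start : Pr {ω | X 0 ω = x} = 1
  /-- The Markov property: for times `t 0 ≤ t 1 ≤ … ≤ t (m + 1)`, the conditional probability of
  `X (t (m + 1)) = y (m + 1)` given `X (t l) = y l`, `l ≤ m`, is the transition probability from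
  `y m` to `y (m + 1)` (written without a division). -/
  markov : ∀ (m : ℕ) (t : ℕ → ℝ≥0) (y : ℕ → State), Monotone t →
    Pr {ω | ∀ l ≤ m + 1, X (t l) ω = y l} =
      Pr {ω | ∀ l ≤ m, X (t l) ω = y l} *
        ENNReal.ofReal (P ((t (m + 1) : ℝ) - (t m : ℝ)) (y m) (y (m + 1)))

/-- The first time at which `X` visits the state `j ∈ S`, equal to `⊤` if this never happens. -/
noncomputable def hitTime {Ω : Type*} (X : ℝ≥0 → Ω → State) (j : ℕ) : Ω → WithTop ℝ≥0 :=
  hittingAfter X {st j} 0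

/-- `πₙ = (λ₀ ⋯ λₙ₋₁) / (μ₁ ⋯ μₙ)`. -/
noncomputable def piCoeff (lam mu : ℕ → ℝ) (n : ℕ) : ℝ :=
  (∏ i ∈ Finset.range n, lam i) / ∏ i ∈ Finset.range n, mu (i + 1)

/-- `Kₙ = π₀ + ⋯ + πₙ`. -/
noncomputable def K (lam mu : ℕ → ℝ) (n : ℕ) : ℝ :=
  ∑ i ∈ Finset.range (n + 1), piCoeff lam mu i

/-- `Lₙ = (λ₀π₀)⁻¹ + ⋯ + (λₙπₙ)⁻¹`. -/
noncomputable def L (lam mu : ℕ → ℝ) (n : ℕ) : ℝ :=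
  ∑ i ∈ Finset.range (n + 1), (lam i * piCoeff lam mu i)⁻¹

/-- `K_∞`, possibly infinite. -/
noncomputable def KInf (lam mu : ℕ → ℝ) : ℝ≥0∞ :=
  ∑' i, ENNReal.ofReal (piCoeff lam mu i)

/-- `L_∞`, possibly infinite. -/
noncomputable def LInf (lam mu : ℕ → ℝ) : ℝ≥0∞ :=
  ∑' i, ENNReal.ofReal ((lam i * piCoeff lam mu i)⁻¹)

/-- `C = ∑ₙ (λₙπₙ)⁻¹ Kₙ`, possibly infinite. -/
noncomputable def C (lam mu : ℕ → ℝ) : ℝ≥0∞ :=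
  ∑' n, ENNReal.ofReal ((lam n * piCoeff lam mu n)⁻¹) * ENNReal.ofReal (K lam mu n)

/-- `D = ∑ₙ (λₙπₙ)⁻¹ (K_∞ - Kₙ)`, possibly infinite. -/
noncomputable def D (lam mu : ℕ → ℝ) : ℝ≥0∞ :=
  ∑' n, ENNReal.ofReal ((lam n * piCoeff lam mu n)⁻¹) * (KInf lam mu - ENNReal.ofReal (K lam mu n))

end BirthDeath

namespace BirthDeath

open Filter

/-! The scale function `S_j = ∑_{i<j} (λᵢπᵢ)⁻¹` is harmonic on `{1, 2, …}`, and `1 + μ₀ S_j` is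
harmonic on all of `S` if it is given the value `0` at `-1`. Hence `(1 + μ₀ S_j) / (1 + μ₀ S_n)`
should be the probability of reaching `n` from `j ≤ n`, and `1 - S_j / S_N` that of reaching `0`
from `j` before `N`.

Optional stopping is carried out on the skeletons at times `l * 2⁻ᵏ`. By right-continuity, hitting a
state is the increasing union of hitting it along the skeletons (`hit_subset_iUnion_dyadicHit`). A
skeleton can jump over states, so a harmonic function is superharmonic for it only up to `o(t)`.
Adding `ε` times a mean hitting time makes the generator at most `-ε`; on a finite set this slack
beats the error for small `t` (`eventually_tsum_le`), and then `ε → 0`. This yields both bounds for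
the first formula and, with `N → ∞`, the lower bound for the second.

The upper bound for the second formula involves all of `S`, where a generator inequality on finite
sets does not see the behaviour at infinity. If `L_∞ = ∞`, the bound is trivial. Otherwise `C + D =
∞` forces `K_∞ = ∞`, and the forward equation shows that the tail `R_j = L_∞ - S_j` is superharmonic
for every `P_t` (`sum_mul_scaleTail_le`): an excess would have to flow in from infinity, and would
keep the process in each distant state `n` for an expected time of order `πₙ`, which is not
summable. So `R_n / R_0` bounds the probability of reaching `0`. -/

/-! ### Superharmonic functions and exit probabilities of discrete-time chains -/

/-- `Y` is a discrete-time Markov chain on a countable set with initial state `x₀` and transition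
matrix `p`. -/
structure IsDiscreteChain {Ω α : Type*} [MeasurableSpace Ω] (Pr : Measure Ω) (Y : ℕ → Ω → α)
    (p : α → α → ℝ≥0∞) (x₀ : α) : Prop where
  measurable : ∀ l y, MeasurableSet {ω | Y l ω = y}
  start : ∀ x, Pr {ω | Y 0 ω = x} ≤ Set.indicator {x₀} 1 x
  markov : ∀ (m : ℕ) (y : ℕ → α),
    Pr {ω | ∀ l ≤ m + 1, Y l ω = y l} = Pr {ω | ∀ l ≤ m, Y l ω = y l} * p (y m) (y (m + 1))

/-- The event that `Y` is in `A` before time `m` and in `x` at time `m`. -/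
def tabooEvent {Ω α : Type*} (Y : ℕ → Ω → α) (A : Set α) (m : ℕ) (x : α) : Set Ω :=
  {ω | (∀ l < m, Y l ω ∈ A) ∧ Y m ω = x}

namespace IsDiscreteChain

variable {Ω α : Type*} [MeasurableSpace Ω] {Pr : Measure Ω} {Y : ℕ → Ω → α}
  {p : α → α → ℝ≥0∞} {x₀ : α}

theorem measurableSet_path (h : IsDiscreteChain Pr Y p x₀) (m : ℕ) (y : ℕ → α) :
    MeasurableSet {ω | ∀ l ≤ m, Y l ω = y l} := by
  simp only [Set.ofPred_forall]
  exact MeasurableSet.iInter fun l => MeasurableSet.iInter fun _ => h.measurable l _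

variable [Countable α]

theorem measurableSet_tabooEvent (h : IsDiscreteChain Pr Y p x₀) (A : Set α) (m : ℕ) (x : α) :
    MeasurableSet (tabooEvent Y A m x) := by
  have key : ∀ l, MeasurableSet {ω | Y l ω ∈ A} := fun l => by
    have : {ω | Y l ω ∈ A} = ⋃ a : A, {ω | Y l ω = a} := by ext; simp
    rw [this]
    exact MeasurableSet.iUnion fun a => h.measurable l _
  have h1 : tabooEvent Y A m x = (⋂ l < m, {ω | Y l ω ∈ A}) ∩ {ω | Y m ω = x} := by
    ext
    simp [tabooEvent]
  rw [h1]
  exact (MeasurableSet.iInter fun l => MeasurableSet.iInter fun _ => key l).inter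
    (h.measurable m x)

/-- The Markov property is given only for single paths. The taboo event is a countable disjoint
union of them, indexed by the first `m` states. -/
theorem measure_taboo_inter (h : IsDiscreteChain Pr Y p x₀) (A : Set α) (m : ℕ) (x y : α) :
    Pr (tabooEvent Y A m x ∩ {ω | Y (m + 1) ω = y}) = Pr (tabooEvent Y A m x) * p x y := by
  classical
  -- One extension of `z`, with value `x` at time `m` and `y` after it, describes the path up to
  -- time `m` as well as up to time `m + 1`.
  let e : (Fin m → A) → ℕ → α := fun z l =>
    if hl : l < m then z ⟨l, hl⟩ else if l = m then x else y
  have em : ∀ z, e z m = x := fun z => by simp [e]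
  have em1 : ∀ z, e z (m + 1) = y := fun z => by simp [e]
  have el : ∀ z (l : Fin m), e z l = z l := fun z l => by simp [e]
  have h1 : tabooEvent Y A m x = ⋃ z : Fin m → A, {ω | ∀ l ≤ m, Y l ω = e z l} := by
    ext ω
    simp only [tabooEvent, Set.mem_ofPred_eq, Set.mem_iUnion]
    constructor
    · rintro ⟨h1, h2⟩
      let z : Fin m → A := fun l => ⟨Y l ω, h1 l l.2⟩
      refine ⟨z, fun l hl => ?_⟩
      rcases hl.lt_or_eq with hl | hl
      · exact (el z ⟨l, hl⟩).symm
      · rw [hl, em, h2]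
    · rintro ⟨z, hz⟩
      refine ⟨fun l hl => ?_, by rw [hz m le_rfl, em]⟩
      rw [hz l hl.le, el z ⟨l, hl⟩]
      exact (z _).2
  have h2 : tabooEvent Y A m x ∩ {ω | Y (m + 1) ω = y} =
      ⋃ z : Fin m → A, {ω | ∀ l ≤ m + 1, Y l ω = e z l} := by
    rw [h1, Set.iUnion_inter]
    refine Set.iUnion_congr fun z => ?_
    ext ω
    simp only [Set.mem_inter_iff, Set.mem_ofPred_eq]
    constructor
    · rintro ⟨h1, h2⟩ l hl
      rcases hl.lt_or_eq with hl | rfl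
      · exact h1 l (by omega)
      · rw [em1, h2]
    · intro h1
      exact ⟨fun l hl => h1 l (by omega), by rw [h1 _ le_rfl, em1]⟩
  have disj : ∀ k, m ≤ k →
      Pairwise (Function.onFun Disjoint fun z : Fin m → A => {ω | ∀ l ≤ k, Y l ω = e z l}) := by
    intro k hk z z' hzz
    refine Set.disjoint_left.2 fun ω h1 h2 => hzz ?_
    ext l
    have hl : (l : ℕ) ≤ k := by omega
    rw [← el z l, ← el z' l, ← h1 l hl, ← h2 l hl]
  rw [h2, h1, measure_iUnion (disj _ (Nat.le_succ m)) fun z => h.measurableSet_path _ _,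
    measure_iUnion (disj _ le_rfl) fun z => h.measurableSet_path _ _, ← ENNReal.tsum_mul_right]
  refine tsum_congr fun z => ?_
  rw [h.markov, em, em1]

theorem measure_tabooEvent_succ (h : IsDiscreteChain Pr Y p x₀) (A : Set α) (m : ℕ) (y : α) :
    Pr (tabooEvent Y A (m + 1) y) = ∑' x : A, Pr (tabooEvent Y A m x) * p x y := by
  have h1 : tabooEvent Y A (m + 1) y =
      ⋃ x : A, tabooEvent Y A m x ∩ {ω | Y (m + 1) ω = y} := by
    ext ω
    simp only [tabooEvent, Set.mem_ofPred_eq, Set.mem_iUnion, Set.mem_inter_iff]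
    constructor
    · rintro ⟨h1, h2⟩
      exact ⟨⟨Y m ω, h1 m (Nat.lt_succ_self m)⟩, ⟨fun l hl => h1 l (by omega), rfl⟩, h2⟩
    · rintro ⟨x, ⟨h1, h2⟩, h3⟩
      refine ⟨fun l hl => ?_, h3⟩
      rcases (Nat.lt_succ_iff.1 hl).lt_or_eq with hl | rfl
      · exact h1 l hl
      · rw [h2]
        exact x.2
  rw [h1, measure_iUnion]
  · exact tsum_congr fun x => h.measure_taboo_inter A m x y
  · intro x x' hxx
    refine Set.disjoint_left.2 fun ω h1 h2 => hxx ?_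
    ext
    rw [← h1.1.2, ← h2.1.2]
  · exact fun x => (h.measurableSet_tabooEvent A m x).inter (h.measurable _ _)

/-- The inequality behind optional stopping at the exit from `A`, for a function `w` which
decreases by at least `c` on average in each step from `A`. -/
theorem sum_exit_le (h : IsDiscreteChain Pr Y p x₀) (A : Set α) (w : α → ℝ≥0∞) (c : ℝ≥0∞)
    (hw : ∀ x ∈ A, ∑' y, p x y * w y + c ≤ w x) (m : ℕ) :
    (∑ l ∈ Finset.range (m + 1), ∑' x : ↥Aᶜ, Pr (tabooEvent Y A l x) * w x) +
      ∑' x : A, Pr (tabooEvent Y A m x) * w x +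
      ∑ l ∈ Finset.range m, c * ∑' x : A, Pr (tabooEvent Y A l x) ≤ w x₀ := by
  have split : ∀ f : α → ℝ≥0∞, ∑' x : ↥Aᶜ, f x + ∑' x : A, f x = ∑' x, f x := fun f => by
    rw [add_comm]
    exact ENNReal.summable.tsum_add_tsum_compl ENNReal.summable
  classical
  induction m with
  | zero =>
    simp only [zero_add, Finset.range_one, Finset.sum_singleton, Finset.range_zero,
      Finset.sum_empty, add_zero]
    rw [split fun x => Pr (tabooEvent Y A 0 x) * w x]
    calc ∑' x, Pr (tabooEvent Y A 0 x) * w x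
        ≤ ∑' x, if x = x₀ then w x₀ else 0 := by
          refine ENNReal.tsum_le_tsum fun x => ?_
          have := h.start x
          have h2 : tabooEvent Y A 0 x = {ω | Y 0 ω = x} := by simp [tabooEvent]
          rw [h2]
          split_ifs with hx
          · subst hx
            simpa using mul_le_mul_left this (w x)
          · simp only [Set.indicator, Set.mem_singleton_iff, hx, if_false, nonpos_iff_eq_zero]
              at this
            simp [this]
      _ = w x₀ := tsum_ite_eq _ _
  | succ m ih =>
    refine le_trans ?_ ih
    rw [Finset.sum_range_succ, Finset.sum_range_succ (fun l => c * _) m]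
    -- Only the mass still in `A` moves in the next step, and its mean weight drops by at least `c`
    -- per unit of mass.
    have key : ∑' x : ↥Aᶜ, Pr (tabooEvent Y A (m + 1) x) * w x +
        ∑' x : A, Pr (tabooEvent Y A (m + 1) x) * w x +
        c * ∑' x : A, Pr (tabooEvent Y A m x) ≤ ∑' x : A, Pr (tabooEvent Y A m x) * w x := by
      rw [split fun x => Pr (tabooEvent Y A (m + 1) x) * w x]
      calc _ = ∑' x : A, Pr (tabooEvent Y A m x) * (∑' y, p x y * w y + c) := by
            simp_rw [h.measure_tabooEvent_succ, ← ENNReal.tsum_mul_right, mul_add]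
            rw [ENNReal.tsum_comm, ENNReal.tsum_add, ENNReal.tsum_mul_right, mul_comm c]
            simp_rw [← ENNReal.tsum_mul_left, mul_assoc]
        _ ≤ _ := ENNReal.tsum_le_tsum fun x => by
            gcongr
            exact hw x x.2
    calc _ = (∑ l ∈ Finset.range (m + 1), ∑' x : ↥Aᶜ, Pr (tabooEvent Y A l x) * w x) +
          (∑' x : ↥Aᶜ, Pr (tabooEvent Y A (m + 1) x) * w x +
            ∑' x : A, Pr (tabooEvent Y A (m + 1) x) * w x +
            c * ∑' x : A, Pr (tabooEvent Y A m x)) +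
          ∑ l ∈ Finset.range m, c * ∑' x : A, Pr (tabooEvent Y A l x) := by ring
      _ ≤ _ := by gcongr

/-- A superharmonic function bounds the probability of leaving `A` into `B`. -/
theorem measure_exit_le (h : IsDiscreteChain Pr Y p x₀) (A B : Set α) (w : α → ℝ≥0∞)
    (hw : ∀ x ∈ A, ∑' y, p x y * w y ≤ w x) (hAB : Disjoint A B) (hB : ∀ x ∈ B, 1 ≤ w x) :
    Pr {ω | ∃ l, Y l ω ∈ B ∧ ∀ k < l, Y k ω ∈ A} ≤ w x₀ := by
  have hsub : {ω | ∃ l, Y l ω ∈ B ∧ ∀ k < l, Y k ω ∈ A} ⊆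
      ⋃ l, ⋃ x : B, tabooEvent Y A l x := by
    rintro ω ⟨l, h1, h2⟩
    simp only [Set.mem_iUnion]
    exact ⟨l, ⟨_, h1⟩, h2, rfl⟩
  have hBA : B ⊆ Aᶜ := fun x hx hA => Set.disjoint_left.1 hAB hA hx
  calc _ ≤ ∑' l, ∑' x : B, Pr (tabooEvent Y A l x) :=
        (measure_mono hsub).trans ((measure_iUnion_le _).trans
          (ENNReal.tsum_le_tsum fun l => measure_iUnion_le _))
    _ ≤ ∑' l, ∑' x : ↥Aᶜ, Pr (tabooEvent Y A l x) * w x := by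
        refine ENNReal.tsum_le_tsum fun l => ?_
        refine le_trans (ENNReal.tsum_le_tsum fun x => ?_)
          (ENNReal.tsum_mono_subtype (fun x => Pr (tabooEvent Y A l x) * w x) hBA)
        exact le_mul_of_one_le_right' (hB x x.2)
    _ ≤ w x₀ := by
        rw [ENNReal.tsum_eq_iSup_nat]
        refine iSup_le fun m => ?_
        refine le_trans ?_ (h.sum_exit_le A w 0 (by simpa using hw) m)
        rw [add_assoc]
        refine le_trans ?_ le_self_add
        exact Finset.sum_le_sum_of_subset (Finset.range_mono (Nat.le_succ m))

/-- A chain does not stay forever in a set on which a finite function decreases on average. -/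
theorem measure_stay_eq_zero (h : IsDiscreteChain Pr Y p x₀) (A : Set α) (w : α → ℝ≥0∞)
    (c : ℝ≥0∞) (hc : c ≠ 0) (hw : ∀ x ∈ A, ∑' y, p x y * w y + c ≤ w x) (hx : w x₀ ≠ ⊤) :
    Pr {ω | ∀ l, Y l ω ∈ A} = 0 := by
  by_contra hne
  have hr : ∀ l, Pr {ω | ∀ l, Y l ω ∈ A} ≤ ∑' x : A, Pr (tabooEvent Y A l x) := fun l => by
    refine le_trans (measure_mono ?_) (measure_iUnion_le _)
    intro ω hω
    simp only [Set.mem_iUnion]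
    exact ⟨⟨Y l ω, hω l⟩, fun k _ => hω k, rfl⟩
  -- Each of the first `m` steps costs at least `c` times the probability of staying forever, and
  -- the total budget is `w x₀`.
  have hm : ∀ m : ℕ, m * (c * Pr {ω | ∀ l, Y l ω ∈ A}) ≤ w x₀ := fun m => by
    refine le_trans ?_ (le_add_self.trans (h.sum_exit_le A w c hw m))
    rw [← nsmul_eq_mul, ← Finset.card_range m, ← Finset.sum_const, Finset.card_range]
    exact Finset.sum_le_sum fun l _ => by gcongr; exact hr l
  obtain ⟨m, hlt⟩ := ENNReal.exists_nat_mul_gt (mul_ne_zero hc hne) hx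
  exact absurd (hm m) (not_le.2 hlt)

/-- A superharmonic function bounds the probability that a state `z` is not reached. -/
theorem one_le_measure_hit_add [IsProbabilityMeasure Pr] (h : IsDiscreteChain Pr Y p x₀)
    (A : Set α) (z : α) (w : α → ℝ≥0∞) (c : ℝ≥0∞) (hc : c ≠ 0)
    (hw : ∀ x ∈ A, ∑' y, p x y * w y + c ≤ w x) (hx : w x₀ ≠ ⊤)
    (hB : ∀ x ∉ A, x ≠ z → 1 ≤ w x) :
    1 ≤ Pr {ω | ∃ l, Y l ω = z} + w x₀ := by
  -- At the first exit from `A` the chain is either at `z` or at a state of weight at least one; the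
  -- third event, no exit at all, is null.
  have hcover : (Set.univ : Set Ω) ⊆ {ω | ∃ l, Y l ω = z} ∪
      ({ω | ∃ l, Y l ω ∈ (A ∪ {z})ᶜ ∧ ∀ k < l, Y k ω ∈ A} ∪ {ω | ∀ l, Y l ω ∈ A}) := by
    intro ω _
    by_cases h1 : ∀ l, Y l ω ∈ A
    · exact Or.inr (Or.inr h1)
    push Not at h1
    classical
    by_cases h2 : Y (Nat.find h1) ω = z
    · exact Or.inl ⟨_, h2⟩
    · refine Or.inr (Or.inl ⟨Nat.find h1, ?_, fun k hk => not_not.1 (Nat.find_min h1 hk)⟩)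
      simp only [Set.mem_compl_iff, Set.mem_union, Set.mem_singleton_iff, not_or]
      exact ⟨Nat.find_spec h1, h2⟩
  calc (1 : ℝ≥0∞) = Pr Set.univ := measure_univ.symm
    _ ≤ _ := measure_mono hcover
    _ ≤ _ := measure_union_le _ _
    _ ≤ _ := by
        gcongr
        refine (measure_union_le _ _).trans ?_
        rw [h.measure_stay_eq_zero A w c hc hw hx, add_zero]
        refine h.measure_exit_le A _ w (fun x hxA => le_self_add.trans (hw x hxA)) ?_ ?_
        · exact Set.disjoint_left.2 fun x hxA hxB => hxB (Or.inl hxA)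
        · intro x hxB
          simp only [Set.mem_compl_iff, Set.mem_union, Set.mem_singleton_iff, not_or] at hxB
          exact hB x hxB.1 hxB.2

/-- A superharmonic function bounds the probability of hitting a set. -/
theorem measure_hit_le (h : IsDiscreteChain Pr Y p x₀) (B : Set α) (w : α → ℝ≥0∞)
    (hw : ∀ x ∉ B, ∑' y, p x y * w y ≤ w x) (hB : ∀ x ∈ B, 1 ≤ w x) :
    Pr {ω | ∃ l, Y l ω ∈ B} ≤ w x₀ := by
  refine le_trans (measure_mono ?_) (h.measure_exit_le Bᶜ B w hw disjoint_compl_left hB)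
  classical
  intro ω hω
  exact ⟨Nat.find hω, Nat.find_spec hω, fun k hk => Nat.find_min hω hk⟩

end IsDiscreteChain

/-! ### The state space -/

theorem st_injective : Function.Injective st := fun i j h => by
  simpa [st] using h

@[simp] theorem st_inj {i j : ℕ} : st i = st j ↔ i = j := st_injective.eq_iff

@[simp] theorem st_ne_bot (i : ℕ) : st i ≠ ⊥ := WithBot.coe_ne_bot

@[simp] theorem st_ne_top (i : ℕ) : st i ≠ ⊤ := by
  intro h
  exact ENat.natCast_ne_top i (WithBot.coe_injective h)

theorem state_cases (x : State) : x = ⊥ ∨ x = ⊤ ∨ ∃ i, x = st i := by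
  rcases x with _ | _ | i
  exacts [Or.inl rfl, Or.inr (Or.inl rfl), Or.inr (Or.inr ⟨i, rfl⟩)]

theorem isOpen_singleton_st (i : ℕ) : IsOpen ({st i} : Set State) := by
  have h : ({st i} : Set State) = (fun a : ℕ∞ => (a : WithBot ℕ∞)) '' {(i : ℕ∞)} := by
    simp [st]
  rw [h]
  exact WithBot.isOpenEmbedding_coe.isOpenMap _ (ENat.isOpen_singleton (ENat.natCast_ne_top i))

/-! ### Dyadic skeletons of the process -/

section Skeleton

variable {Ω : Type*} {X : ℝ≥0 → Ω → State}

theorem hitTime_lt_top_iff {j : ℕ} {ω : Ω} : hitTime X j ω < ⊤ ↔ ∃ t, X t ω = st j := by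
  rw [hitTime, hittingAfter_def]
  simp only [Set.mem_singleton_iff, zero_le, true_and]
  split_ifs with h
  · exact ⟨fun _ => by simpa using h, fun _ => WithTop.coe_lt_top _⟩
  · simpa using h

/-- The event that the process is in state `j` at some multiple of `2⁻ᵏ`. -/
def dyadicHit (X : ℝ≥0 → Ω → State) (j k : ℕ) : Set Ω :=
  {ω | ∃ l : ℕ, X (l * (2 ^ k)⁻¹) ω = st j}

theorem dyadicHit_mono (j : ℕ) : Monotone (dyadicHit X j) := by
  refine monotone_nat_of_le_succ fun k ω ⟨l, hl⟩ => ⟨l * 2, ?_⟩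
  have h : ((l * 2 : ℕ) : ℝ≥0) * (2 ^ (k + 1))⁻¹ = l * (2 ^ k)⁻¹ := by
    push_cast
    rw [pow_succ]
    field_simp
  rw [h, hl]

theorem dyadicHit_subset (j k : ℕ) : dyadicHit X j k ⊆ {ω | hitTime X j ω < ⊤} :=
  fun _ ⟨_, hl⟩ => hitTime_lt_top_iff.2 ⟨_, hl⟩

theorem tendsto_inv_two_pow : Tendsto (fun k : ℕ => (((2 ^ k)⁻¹ : ℝ≥0) : ℝ)) atTop (𝓝[>] 0) := by
  refine tendsto_nhdsWithin_iff.2 ⟨?_, Eventually.of_forall fun k => by simp⟩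
  have := tendsto_pow_atTop_nhds_zero_of_lt_one (r := (2 : ℝ)⁻¹) (by norm_num) (by norm_num)
  simpa using this

/-- Since `{st j}` is open, a right-continuous path that is in `j` at time `t` stays there on some
`[t, b)`, which contains a dyadic time. -/
theorem hit_subset_iUnion_dyadicHit
    (hX : ∀ ω t, ContinuousWithinAt (fun u => X u ω) (Set.Ici t) t) (j : ℕ) :
    {ω | hitTime X j ω < ⊤} ⊆ ⋃ k, dyadicHit X j k := by
  intro ω hω
  obtain ⟨t, ht⟩ := hitTime_lt_top_iff.1 hω
  have h1 : ∀ᶠ u in 𝓝[≥] t, X u ω = st j :=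
    (hX ω t).eventually ((isOpen_singleton_st j).mem_nhds (by simpa using ht))
  obtain ⟨b, htb, hb⟩ := (mem_nhdsGE_iff_exists_Ico_subset (a := t)).1 h1
  have htb' : (t : ℝ) < b := htb
  obtain ⟨k, hk⟩ := ((tendsto_inv_two_pow.mono_right nhdsWithin_le_nhds).eventually
    (gt_mem_nhds (sub_pos.2 htb'))).exists
  -- The first multiple of `2⁻ᵏ` that is at least `t` exceeds `t` by less than `2⁻ᵏ < b - t`.
  refine Set.mem_iUnion.2 ⟨k, ⌈t * 2 ^ k⌉₊, hb ⟨?_, ?_⟩⟩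
  · have := Nat.le_ceil (t * 2 ^ k)
    rw [← div_eq_mul_inv, le_div_iff₀ (by positivity)]
    exact this
  · have := Nat.ceil_lt_add_one (a := t * 2 ^ k) (by positivity)
    rw [← NNReal.coe_lt_coe]
    have h2 : ((⌈t * 2 ^ k⌉₊ : ℝ≥0) : ℝ) < t * 2 ^ k + 1 := by exact_mod_cast this
    push_cast at hk h2 ⊢
    calc (⌈t * 2 ^ k⌉₊ : ℝ) * (2 ^ k)⁻¹ < (t * 2 ^ k + 1) * (2 ^ k)⁻¹ := by gcongr
      _ = t + (2 ^ k)⁻¹ := by field_simp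
      _ < b := by linarith

variable [MeasurableSpace Ω] {P : ℝ → State → State → ℝ} {Pr : Measure Ω} {x : State}

theorem IsMarkovChainFrom.isDiscreteChain (h : IsMarkovChainFrom P x X Pr) (s : ℝ≥0) :
    IsDiscreteChain Pr (fun l : ℕ => X (l * s)) (fun a b => ENNReal.ofReal (P s a b)) x where
  measurable l y := h.measurable _ y
  start y := by
    have := h.isProbabilityMeasure
    simp only [Nat.cast_zero, zero_mul]
    by_cases hy : y = x
    · subst hy
      simp [h.start]
    · have h0 : Pr {ω | X 0 ω = x}ᶜ = 0 :=
        (prob_compl_eq_zero_iff (h.measurable 0 x)).2 h.start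
      simp only [Set.indicator, Set.mem_singleton_iff, hy, if_false, nonpos_iff_eq_zero]
      refine measure_mono_null (fun ω hω => ?_) h0
      intro hx
      exact hy (Eq.trans (Eq.symm hω) hx)
  markov m y := by
    have := h.markov m (fun l => l * s) y (fun a b hab => by dsimp only; gcongr)
    rw [this]
    congr 3
    push_cast
    ring

/-- Continuity from below along the increasing events `dyadicHit`: a bound valid for all fine
skeletons passes to the process. -/
theorem IsMarkovChainFrom.measure_hit_le (h : IsMarkovChainFrom P x X Pr) (j : ℕ) {b : ℝ≥0∞}
    (hb : ∀ᶠ k in atTop, Pr (dyadicHit X j k) ≤ b) : Pr {ω | hitTime X j ω < ⊤} ≤ b :=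
  (measure_mono (hit_subset_iUnion_dyadicHit h.rightContinuous j)).trans
    (le_of_tendsto (tendsto_measure_iUnion_atTop (dyadicHit_mono j)) hb)

end Skeleton

/-! ### From generator inequalities to superharmonicity for small times -/

section Generator

variable {lam mu : ℕ → ℝ} {P : ℝ → State → State → ℝ}

theorem IsTransitionFunction.of_bot (hP : IsTransitionFunction lam mu P) {t : ℝ} (ht : 0 ≤ t)
    {y : State} (hy : y ≠ ⊥) : P t ⊥ y = 0 := by
  refine le_antisymm ?_ (hP.nonneg t ht _ _)
  have h1 := sum_le_hasSum {⊥, y} (fun z _ => hP.nonneg t ht ⊥ z) (hP.hasSum_one t ht ⊥)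
  rw [Finset.sum_pair hy.symm, hP.absorbing_bot t ht] at h1
  linarith

theorem IsTransitionFunction.of_top (hP : IsTransitionFunction lam mu P) {t : ℝ} (ht : 0 ≤ t)
    {y : State} (hy : y ≠ ⊤) : P t ⊤ y = 0 := by
  refine le_antisymm ?_ (hP.nonneg t ht _ _)
  have h1 := sum_le_hasSum {⊤, y} (fun z _ => hP.nonneg t ht ⊤ z) (hP.hasSum_one t ht ⊤)
  rw [Finset.sum_pair hy.symm, hP.absorbing_top t ht] at h1
  linarith

theorem sum_range_q_left (f : ℕ → ℝ) (N : ℕ) (hf : ∀ j, N ≤ j → f j = 0) (i : ℕ) :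
    ∑ j ∈ Finset.range N, q lam mu i j * f j =
      ∑ j ∈ Finset.range (i + 2), q lam mu i j * f j := by
  have h1 : ∑ j ∈ Finset.range N, q lam mu i j * f j =
      ∑ j ∈ Finset.range (max N (i + 2)), q lam mu i j * f j := by
    refine Finset.sum_subset (Finset.range_mono (le_max_left _ _)) fun j _ hj => ?_
    rw [hf j (by simpa using hj), mul_zero]
  have h2 : ∑ j ∈ Finset.range (i + 2), q lam mu i j * f j =
      ∑ j ∈ Finset.range (max N (i + 2)), q lam mu i j * f j := by
    refine Finset.sum_subset (Finset.range_mono (le_max_right _ _)) fun j _ hj => ?_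
    have : i + 2 ≤ j := by simpa using hj
    rw [q, if_neg (by omega), if_neg (by omega), if_neg (by omega), zero_mul]
  rw [h1, h2]

/-- The generator of the birth-death process applied to the function with values `f i` at the
states `i ∈ S` and `fb` at the state `-1`. -/
def gen (lam mu : ℕ → ℝ) (fb : ℝ) (f : ℕ → ℝ) : ℕ → ℝ
  | 0 => lam 0 * (f 1 - f 0) + mu 0 * (fb - f 0)
  | i + 1 => lam (i + 1) * (f (i + 2) - f (i + 1)) + mu (i + 1) * (f i - f (i + 1))

theorem sum_q_left (fb : ℝ) (f : ℕ → ℝ) (i : ℕ) :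
    ∑ j ∈ Finset.range (i + 2), q lam mu i j * f j + (if i = 0 then mu 0 else 0) * fb =
      gen lam mu fb f i := by
  cases i with
  | zero =>
    simp [Finset.sum_range_succ, q, gen]
    ring
  | succ i =>
    rw [Finset.sum_range_succ, Finset.sum_range_succ, Finset.sum_range_succ, Finset.sum_eq_zero]
    · simp [q, gen, show i ≠ i + 1 + 1 by omega]
      ring
    · intro j hj
      have : j < i := by simpa using hj
      rw [q, if_neg (by omega), if_neg (by omega), if_neg (by omega), zero_mul]

/-- The function on the state space with values `1 + f i` at `i ∈ S`, `1 + fb` at `-1` and `1` at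
`∞`, when `f` vanishes on `[N, ∞)`. -/
noncomputable def weight (N : ℕ) (fb : ℝ) (f : ℕ → ℝ) (x : State) : ℝ :=
  1 + ((if x = ⊥ then fb else 0) + ∑ j ∈ Finset.range N, if x = st j then f j else 0)

@[simp] theorem weight_bot (N : ℕ) (fb : ℝ) (f : ℕ → ℝ) : weight N fb f ⊥ = 1 + fb := by
  simp [weight, (st_ne_bot _).symm]

@[simp] theorem weight_top (N : ℕ) (fb : ℝ) (f : ℕ → ℝ) : weight N fb f ⊤ = 1 := by
  simp [weight, (st_ne_top _).symm]

theorem weight_st {N : ℕ} (fb : ℝ) {f : ℕ → ℝ} (hf : ∀ j, N ≤ j → f j = 0) (i : ℕ) :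
    weight N fb f (st i) = 1 + f i := by
  simp only [weight, st_ne_bot, if_false, zero_add, st_inj, Finset.sum_ite_eq, Finset.mem_range]
  split_ifs with h
  · rfl
  · rw [hf i (not_lt.1 h)]

theorem IsTransitionFunction.hasSum_mul_weight (hP : IsTransitionFunction lam mu P) {t : ℝ}
    (ht : 0 ≤ t) (N : ℕ) (fb : ℝ) (f : ℕ → ℝ) (x : State) :
    HasSum (fun y => P t x y * weight N fb f y)
      (1 + (P t x ⊥ * fb + ∑ j ∈ Finset.range N, P t x (st j) * f j)) := by
  have h1 : ∀ (z : State) (a : ℝ),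
      HasSum (fun y => P t x y * (if y = z then a else 0)) (P t x z * a) := fun z a => by
    convert hasSum_ite_eq z (P t x z * a) using 2 with y
    split_ifs with h
    · rw [h]
    · rw [mul_zero]
  have h2 := (hP.hasSum_one t ht x).add
    ((h1 ⊥ fb).add (hasSum_sum fun j (_ : j ∈ Finset.range N) => h1 (st j) (f j)))
  refine h2.congr_fun ?_
  intro y
  simp only [weight, mul_add, mul_one, Finset.mul_sum]

/-- The weight is constant off a finite set of states, so its mean under `P t` is `1` plus a finite
sum, which can be differentiated term by term at `0`. The derivative is `gen`; being at most `-2c`,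
it forces difference quotients below `-c` near `0`. -/
theorem IsTransitionFunction.eventually_le (hP : IsTransitionFunction lam mu P) {N : ℕ} {fb : ℝ}
    {f : ℕ → ℝ} (hf : ∀ j, N ≤ j → f j = 0) {i : ℕ} {c : ℝ} (hc : 0 < c)
    (hgen : gen lam mu fb f i ≤ -(2 * c)) :
    ∀ᶠ t in 𝓝[>] (0 : ℝ), 1 + (P t (st i) ⊥ * fb + ∑ j ∈ Finset.range N, P t (st i) (st j) * f j) +
      c * t ≤ 1 + f i := by
  -- At time `0` the backward equation reduces to the `q`-matrix entry, because `P 0` is the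
  -- identity.
  have hq : ∀ j, ∑ k ∈ Finset.range (i + 2), q lam mu i k * P 0 (st k) (st j) = q lam mu i j := by
    intro j
    simp only [hP.zero, st_inj, mul_ite, mul_one, mul_zero, Finset.sum_ite_eq', Finset.mem_range]
    split_ifs with h
    · rfl
    · rw [q, if_neg (by omega), if_neg (by omega), if_neg (by omega)]
  have hd : HasDerivWithinAt
      (fun t => P t (st i) ⊥ * fb + ∑ j ∈ Finset.range N, P t (st i) (st j) * f j)
      (gen lam mu fb f i) (Set.Ici 0) 0 := by
    have h1 := ((hP.evanescence 0 le_rfl i).mul_const fb).add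
      (HasDerivWithinAt.fun_sum fun j (_ : j ∈ Finset.range N) =>
        (hP.backward 0 le_rfl i j).mul_const (f j))
    simp only [hq] at h1
    rw [sum_range_q_left f N hf, add_comm] at h1
    have h2 : P 0 (st i) (st 0) * mu 0 * fb + ∑ j ∈ Finset.range (i + 2), q lam mu i j * f j =
        gen lam mu fb f i := by
      rw [← sum_q_left, add_comm]
      simp [hP.zero]
    rw [h2] at h1
    refine h1.congr_of_mem (fun t _ => ?_) Set.self_mem_Ici
    simp only [Pi.add_apply, add_comm]
  have h2 := hd.limsup_slope_le (r := -c) (by linarith)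
  rw [Set.Ici_sdiff_left] at h2
  filter_upwards [h2, self_mem_nhdsWithin] with t ht ht0
  have ht0 : 0 < t := ht0
  have h0 : P 0 (st i) ⊥ * fb + ∑ j ∈ Finset.range N, P 0 (st i) (st j) * f j = f i := by
    simp only [hP.zero, st_ne_bot, if_false, zero_mul, zero_add, st_inj, ite_mul, one_mul,
      Finset.sum_ite_eq, Finset.mem_range]
    split_ifs with h
    · rfl
    · rw [hf i (not_lt.1 h)]
  rw [slope_def_field, h0, sub_zero, div_lt_iff₀ ht0] at ht
  linarith

theorem IsTransitionFunction.tsum_mul_weight (hP : IsTransitionFunction lam mu P) {t : ℝ}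
    (ht : 0 ≤ t) (N : ℕ) {fb : ℝ} {f : ℕ → ℝ} (hw : ∀ x, 0 ≤ weight N fb f x) (x : State) :
    ∑' y, ENNReal.ofReal (P t x y) * ENNReal.ofReal (weight N fb f y) =
      ENNReal.ofReal (1 + (P t x ⊥ * fb + ∑ j ∈ Finset.range N, P t x (st j) * f j)) := by
  have h := hP.hasSum_mul_weight ht N fb f x
  rw [← h.tsum_eq, ENNReal.ofReal_tsum_of_nonneg _ h.summable]
  · exact tsum_congr fun y => (ENNReal.ofReal_mul (hP.nonneg t ht x y)).symm
  · exact fun y => mul_nonneg (hP.nonneg t ht x y) (hw y)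

theorem IsTransitionFunction.eventually_tsum_le (hP : IsTransitionFunction lam mu P) {N : ℕ}
    {fb : ℝ} {f : ℕ → ℝ} (hf : ∀ j, N ≤ j → f j = 0) (hw : ∀ x, 0 ≤ weight N fb f x) (I : Finset ℕ)
    {c : ℝ} (hc : 0 < c) (hgen : ∀ i ∈ I, gen lam mu fb f i ≤ -(2 * c)) :
    ∀ᶠ t in 𝓝[>] (0 : ℝ), ∀ i ∈ I,
      ∑' y, ENNReal.ofReal (P t (st i) y) * ENNReal.ofReal (weight N fb f y) +
        ENNReal.ofReal (c * t) ≤ ENNReal.ofReal (weight N fb f (st i)) := by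
  rw [Filter.eventually_all_finset]
  intro i hi
  filter_upwards [hP.eventually_le hf hc (hgen i hi), self_mem_nhdsWithin] with t h1 h2
  have ht : (0 : ℝ) < t := h2
  rw [hP.tsum_mul_weight ht.le N hw, ← ENNReal.ofReal_add _ (by positivity), weight_st fb hf]
  · exact ENNReal.ofReal_le_ofReal h1
  · have h := hP.hasSum_mul_weight ht.le N fb f (st i)
    exact h.nonneg fun y => mul_nonneg (hP.nonneg t ht.le _ y) (hw y)

theorem weight_nonneg {N : ℕ} {fb : ℝ} {f : ℕ → ℝ} (hf : ∀ j, N ≤ j → f j = 0) (hb : -1 ≤ fb)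
    (hf1 : ∀ j, -1 ≤ f j) (x : State) : 0 ≤ weight N fb f x := by
  rcases state_cases x with rfl | rfl | ⟨i, rfl⟩
  · rw [weight_bot]
    linarith
  · simp
  · rw [weight_st fb hf]
    linarith [hf1 i]

variable {Ω : Type*} [MeasurableSpace Ω] {X : ℝ≥0 → Ω → State} {Pr : Measure Ω}

/-- A bound from below for the probability of reaching `z`, by a function which decreases on
average on a finite set `I` and is at least one outside `I ∪ {z}`. -/
theorem one_le_measure_hitTime_add (hP : IsTransitionFunction lam mu P) {i₀ : ℕ}
    (hX : IsMarkovChainFrom P (st i₀) X Pr) (I : Finset ℕ) (z N : ℕ) {fb : ℝ} {f : ℕ → ℝ}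
    (hf : ∀ j, N ≤ j → f j = 0) (hb : 0 ≤ fb) (hf1 : ∀ j, -1 ≤ f j)
    (hI : ∀ j ∉ I, j ≠ z → 0 ≤ f j) {c : ℝ} (hc : 0 < c)
    (hgen : ∀ i ∈ I, gen lam mu fb f i ≤ -c) :
    1 ≤ Pr {ω | hitTime X z ω < ⊤} + ENNReal.ofReal (1 + f i₀) := by
  have hw := weight_nonneg hf (by linarith : -1 ≤ fb) hf1
  obtain ⟨k, hk⟩ := (tendsto_inv_two_pow.eventually (hP.eventually_tsum_le hf hw I (half_pos hc)
    (fun i hi => by linarith [hgen i hi]))).exists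
  have hprob := hX.isProbabilityMeasure
  refine (IsDiscreteChain.one_le_measure_hit_add (hX.isDiscreteChain ((2 ^ k)⁻¹)) (st '' I) (st z)
    (fun y => ENNReal.ofReal (weight N fb f y))
    (ENNReal.ofReal (c / 2 * (((2 ^ k)⁻¹ : ℝ≥0) : ℝ))) ?_ ?_ ?_ ?_).trans ?_
  · rw [ne_eq, ENNReal.ofReal_eq_zero, not_le, NNReal.coe_inv, NNReal.coe_pow]
    have : (0 : ℝ) < ((2 : ℝ≥0) : ℝ) := by norm_num
    positivity
  · rintro _ ⟨i, hi, rfl⟩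
    exact hk i hi
  · exact ENNReal.ofReal_ne_top
  · intro x hx hxz
    rw [ENNReal.one_le_ofReal]
    rcases state_cases x with rfl | rfl | ⟨i, rfl⟩
    · rw [weight_bot]
      linarith
    · simp
    · rw [weight_st fb hf]
      have := hI i (fun h => hx ⟨i, h, rfl⟩) (by simpa using hxz)
      linarith
  · rw [weight_st fb hf]
    gcongr
    exact fun h => dyadicHit_subset z k h

/-- A bound from above for the probability of reaching `z`, by a function which vanishes at `-1`,
decreases on average on a finite set `I` and is at least one on the rest of `S`. -/
theorem measure_hitTime_le (hP : IsTransitionFunction lam mu P) {i₀ : ℕ}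
    (hX : IsMarkovChainFrom P (st i₀) X Pr) (I : Finset ℕ) (z N : ℕ) (hz : z ∉ I) {f : ℕ → ℝ}
    (hf : ∀ j, N ≤ j → f j = 0) (hf1 : ∀ j, -1 ≤ f j) (hI : ∀ j ∉ I, 0 ≤ f j) {c : ℝ} (hc : 0 < c)
    (hgen : ∀ i ∈ I, gen lam mu (-1) f i ≤ -c) :
    Pr {ω | hitTime X z ω < ⊤} ≤ ENNReal.ofReal (1 + f i₀) := by
  have hw := weight_nonneg hf le_rfl hf1
  refine hX.measure_hit_le z ((tendsto_inv_two_pow.eventually (hP.eventually_tsum_le hf hw I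
    (half_pos hc) (fun i hi => by linarith [hgen i hi]))).mono fun k hk => ?_)
  have h := (hX.isDiscreteChain ((2 ^ k)⁻¹)).measure_hit_le (insert ⊥ (st '' I))ᶜ
    (fun y => ENNReal.ofReal (weight N (-1) f y)) ?_ ?_
  · rw [weight_st _ hf] at h
    refine (measure_mono ?_).trans h
    rintro ω ⟨l, hl⟩
    refine ⟨l, ?_⟩
    rw [hl]
    simpa using hz
  · intro x hx
    rw [Set.notMem_compl_iff] at hx
    rcases hx with rfl | ⟨i, hi, rfl⟩
    -- The state `-1` is absorbing and has weight `1 + (-1) = 0`.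
    · have h1 : ∀ y : State,
          ENNReal.ofReal (P ↑((2 ^ k)⁻¹ : ℝ≥0) ⊥ y) * ENNReal.ofReal (weight N (-1) f y) = 0 := by
        intro y
        by_cases hy : y = ⊥
        · simp [hy]
        · simp [hP.of_bot (NNReal.coe_nonneg ((2 ^ k)⁻¹)) hy, -NNReal.coe_inv]
      simp only [h1, tsum_zero, zero_le]
    · exact le_self_add.trans (hk i hi)
  · intro x hx
    rw [ENNReal.one_le_ofReal]
    rcases state_cases x with rfl | rfl | ⟨i, rfl⟩
    · simp at hx
    · simp
    · rw [weight_st _ hf]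
      have := hI i (fun h => hx (Or.inr ⟨i, h, rfl⟩))
      linarith

end Generator

/-! ### Scale function, mean hitting times and the test functions -/

section Harmonic

variable {lam mu : ℕ → ℝ}

/-- The sum of the first `n` of the numbers `(λᵢπᵢ)⁻¹`. -/
noncomputable def scaleSum (lam mu : ℕ → ℝ) (n : ℕ) : ℝ :=
  ∑ i ∈ Finset.range n, (lam i * piCoeff lam mu i)⁻¹

theorem scaleSum_succ (lam mu : ℕ → ℝ) (n : ℕ) :
    scaleSum lam mu (n + 1) = scaleSum lam mu n + (lam n * piCoeff lam mu n)⁻¹ :=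
  Finset.sum_range_succ _ _

theorem L_pred {n : ℕ} (hn : 1 ≤ n) : L lam mu (n - 1) = scaleSum lam mu n := by
  rw [L, scaleSum, Nat.sub_add_cancel hn]

theorem piCoeff_zero : piCoeff lam mu 0 = 1 := by simp [piCoeff]

theorem piCoeff_pos (hlam : ∀ i, 0 < lam i) (hmu : ∀ i, 1 ≤ i → 0 < mu i) (n : ℕ) :
    0 < piCoeff lam mu n :=
  div_pos (Finset.prod_pos fun i _ => hlam i) (Finset.prod_pos fun i _ => hmu _ (by omega))

theorem mu_mul_piCoeff_succ (hmu : ∀ i, 1 ≤ i → 0 < mu i) (n : ℕ) :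
    mu (n + 1) * piCoeff lam mu (n + 1) = lam n * piCoeff lam mu n := by
  have h1 := (hmu (n + 1) (by omega)).ne'
  have h2 : ∏ i ∈ Finset.range n, mu (i + 1) ≠ 0 :=
    (Finset.prod_pos fun i _ => hmu (i + 1) (by omega)).ne'
  rw [piCoeff, piCoeff, Finset.prod_range_succ, Finset.prod_range_succ]
  field_simp

/-- This is harmonicity of `scaleSum` at `n + 1`: the upward and downward increments, weighted by
the rates, balance. -/
theorem lam_mul_inv_succ (hlam : ∀ i, 0 < lam i) (hmu : ∀ i, 1 ≤ i → 0 < mu i) (n : ℕ) :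
    lam (n + 1) * (lam (n + 1) * piCoeff lam mu (n + 1))⁻¹ =
      mu (n + 1) * (lam n * piCoeff lam mu n)⁻¹ := by
  rw [← mu_mul_piCoeff_succ hmu n]
  have h1 := (hmu (n + 1) (by omega)).ne'
  have h2 := (hlam (n + 1)).ne'
  have h3 := (piCoeff_pos hlam hmu (n + 1)).ne'
  field_simp

theorem inv_lam_mul_piCoeff_pos (hlam : ∀ i, 0 < lam i) (hmu : ∀ i, 1 ≤ i → 0 < mu i) (n : ℕ) :
    0 < (lam n * piCoeff lam mu n)⁻¹ :=
  inv_pos.2 (mul_pos (hlam n) (piCoeff_pos hlam hmu n))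

theorem scaleSum_strictMono (hlam : ∀ i, 0 < lam i) (hmu : ∀ i, 1 ≤ i → 0 < mu i) :
    StrictMono (scaleSum lam mu) :=
  strictMono_nat_of_lt_succ fun n => by
    rw [scaleSum_succ]
    linarith [inv_lam_mul_piCoeff_pos hlam hmu n]

theorem scaleSum_zero : scaleSum lam mu 0 = 0 := by simp [scaleSum]

theorem scaleSum_nonneg (hlam : ∀ i, 0 < lam i) (hmu : ∀ i, 1 ≤ i → 0 < mu i) (n : ℕ) :
    0 ≤ scaleSum lam mu n := by
  rw [← scaleSum_zero (lam := lam) (mu := mu)]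
  exact (scaleSum_strictMono hlam hmu).monotone (Nat.zero_le n)

/-- The mean time to go from `i` to `i + 1` when `μ₀` is replaced by zero. -/
noncomputable def stepTime (lam mu : ℕ → ℝ) : ℕ → ℝ
  | 0 => 1 / lam 0
  | i + 1 => (1 + mu (i + 1) * stepTime lam mu i) / lam (i + 1)

theorem stepTime_pos (hlam : ∀ i, 0 < lam i) (hmu : ∀ i, 1 ≤ i → 0 < mu i) (i : ℕ) :
    0 < stepTime lam mu i := by
  induction i with
  | zero => exact one_div_pos.2 (hlam 0)
  | succ i ih =>
    have := hmu (i + 1) (by omega)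
    exact div_pos (by positivity) (hlam _)

/-- The mean time to go from `i` to `n` when `μ₀` is replaced by zero. -/
noncomputable def meanTime (lam mu : ℕ → ℝ) (n i : ℕ) : ℝ :=
  ∑ k ∈ Finset.Ico i n, stepTime lam mu k

theorem meanTime_nonneg (hlam : ∀ i, 0 < lam i) (hmu : ∀ i, 1 ≤ i → 0 < mu i) (n i : ℕ) :
    0 ≤ meanTime lam mu n i :=
  Finset.sum_nonneg fun k _ => (stepTime_pos hlam hmu k).le

theorem meanTime_self (n : ℕ) : meanTime lam mu n n = 0 := by simp [meanTime]

theorem meanTime_eq_add {n i : ℕ} (h : i < n) :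
    meanTime lam mu n i = stepTime lam mu i + meanTime lam mu n (i + 1) :=
  Finset.sum_eq_sum_Ico_succ_bot h _

/-- The function equal to `α + β Sⱼ + ε mⱼ` for `j ≤ n` and to zero for `j > n`, where `Sⱼ` is the
scale function and `mⱼ` the mean time to reach `n`. -/
noncomputable def barrier (lam mu : ℕ → ℝ) (n : ℕ) (α β ε : ℝ) (j : ℕ) : ℝ :=
  if j ≤ n then α + β * scaleSum lam mu j + ε * meanTime lam mu n j else 0

/-- The constant and the scale function contribute nothing, while the recursion of `stepTime` gives
the mean time generator `-1`. The condition `i + 1 < n` keeps the right neighbour inside the range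
where the formula of `barrier` applies. -/
theorem gen_barrier_succ (hlam : ∀ i, 0 < lam i) (hmu : ∀ i, 1 ≤ i → 0 < mu i) {n i : ℕ}
    (h : i + 1 < n) (fb α β ε : ℝ) :
    gen lam mu fb (barrier lam mu n α β ε) (i + 1) = -ε := by
  have h1 : lam (i + 1) * stepTime lam mu (i + 1) = 1 + mu (i + 1) * stepTime lam mu i :=
    mul_div_cancel₀ _ (hlam (i + 1)).ne'
  have h2 := lam_mul_inv_succ hlam hmu i
  simp only [gen, barrier]
  rw [if_pos (by omega), if_pos (by omega), if_pos (by omega), scaleSum_succ lam mu (i + 1),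
    scaleSum_succ lam mu i, meanTime_eq_add (show i < n by omega),
    meanTime_eq_add (show i + 1 < n by omega)]
  linear_combination β * h2 - ε * h1

/-- The condition `hα` says that `α + β S` is harmonic at `0` with boundary value `fb` at `-1`. The
mean time ignores `μ₀`, so killing contributes the extra term `-μ₀ ε m₀ ≤ 0`; hence an inequality.
-/
theorem gen_barrier_zero (hlam : ∀ i, 0 < lam i) (hmu : ∀ i, 1 ≤ i → 0 < mu i) (hmu0 : 0 ≤ mu 0)
    {n : ℕ} (h : 0 < n) {fb α β ε : ℝ} (hε : 0 ≤ ε) (hα : β + mu 0 * (fb - α) = 0) :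
    gen lam mu fb (barrier lam mu n α β ε) 0 ≤ -ε := by
  have h0 := (hlam 0).ne'
  have h1 : lam 0 * stepTime lam mu 0 = 1 := mul_div_cancel₀ _ h0
  have h2 : lam 0 * (lam 0 * piCoeff lam mu 0)⁻¹ = 1 := by
    rw [piCoeff_zero, mul_one, mul_inv_cancel₀ h0]
  have h3 : 0 ≤ mu 0 * (ε * meanTime lam mu n 0) :=
    mul_nonneg hmu0 (mul_nonneg hε (meanTime_nonneg hlam hmu n 0))
  simp only [gen, barrier]
  rw [if_pos (by omega), if_pos (by omega), scaleSum_succ, scaleSum_zero]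
  have h4 := meanTime_eq_add (lam := lam) (mu := mu) h
  have h5 : lam 0 * meanTime lam mu n 0 = 1 + lam 0 * meanTime lam mu n 1 := by
    rw [h4, mul_add, h1]
  have h6 : lam 0 * (α + β * (0 + (lam 0 * piCoeff lam mu 0)⁻¹) + ε * meanTime lam mu n (0 + 1) -
        (α + β * 0 + ε * meanTime lam mu n 0)) +
      mu 0 * (fb - (α + β * 0 + ε * meanTime lam mu n 0)) =
      -ε - mu 0 * (ε * meanTime lam mu n 0) := by
    rw [zero_add]
    linear_combination β * h2 - ε * h5 + hα
  linarith

theorem barrier_of_lt {n j : ℕ} (h : n < j) (α β ε : ℝ) : barrier lam mu n α β ε j = 0 :=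
  if_neg (by omega)

theorem barrier_of_le {n j : ℕ} (h : j ≤ n) (α β ε : ℝ) :
    barrier lam mu n α β ε j = α + β * scaleSum lam mu j + ε * meanTime lam mu n j :=
  if_pos h

theorem barrier_self (n : ℕ) (α β ε : ℝ) :
    barrier lam mu n α β ε n = α + β * scaleSum lam mu n := by
  rw [barrier_of_le le_rfl, meanTime_self, mul_zero, add_zero]

theorem neg_one_le_barrier (hlam : ∀ i, 0 < lam i) (hmu : ∀ i, 1 ≤ i → 0 < mu i) (n : ℕ)
    {α β ε : ℝ} (hε : 0 ≤ ε) (h : ∀ j ≤ n, -1 ≤ α + β * scaleSum lam mu j) (j : ℕ) :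
    -1 ≤ barrier lam mu n α β ε j := by
  rcases le_or_gt j n with hj | hj
  · rw [barrier_of_le hj]
    have := mul_nonneg hε (meanTime_nonneg hlam hmu n j)
    linarith [h j hj]
  · rw [barrier_of_lt hj]
    norm_num

end Harmonic

/-! ### Hitting bounds from the test functions -/

section HittingBounds

variable {lam mu : ℕ → ℝ} {P : ℝ → State → State → ℝ} {Ω : Type*} [MeasurableSpace Ω]
  {X : ℝ≥0 → Ω → State} {Pr : Measure Ω}

theorem tendsto_add_ofReal_mul (p : ℝ≥0∞) (a b : ℝ) :
    Tendsto (fun ε : ℝ => p + ENNReal.ofReal (a + ε * b)) (𝓝[>] 0) (𝓝 (p + ENNReal.ofReal a)) := by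
  have h : Continuous fun ε : ℝ => p + ENNReal.ofReal (a + ε * b) :=
    continuous_const.add (ENNReal.continuous_ofReal.comp (by fun_prop))
  have h0 := h.tendsto 0
  rw [zero_mul, add_zero] at h0
  exact h0.mono_left nhdsWithin_le_nhds

theorem measure_hitTime_from_zero_le (hlam : ∀ i, 0 < lam i) (hmu : ∀ i, 1 ≤ i → 0 < mu i)
    (hmu0 : 0 ≤ mu 0) (hP : IsTransitionFunction lam mu P) {n : ℕ}
    (hX : IsMarkovChainFrom P (st 0) X Pr) :
    Pr {ω | hitTime X n ω < ⊤} ≤ ENNReal.ofReal (1 / (1 + mu 0 * scaleSum lam mu n)) := by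
  set M := 1 + mu 0 * scaleSum lam mu n with hM
  have hM0 : 0 < M := by
    have := mul_nonneg hmu0 (scaleSum_nonneg hlam hmu n)
    linarith
  have key : ∀ ε : ℝ, 0 < ε → Pr {ω | hitTime X n ω < ⊤} ≤
      0 + ENNReal.ofReal (1 / M + ε * meanTime lam mu n 0) := by
    intro ε hε
    have hself : 1 / M - 1 + mu 0 / M * scaleSum lam mu n = 0 := by
      field_simp
      rw [hM]
      ring
    -- Up to the `ε` term the weight is `(1 + μ₀ S_j) / M` for `j ≤ n`, the expected hitting
    -- probability: `0` at `-1` and `1` at `n`. It is `1` above `n`, so overshooting skeletons are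
    -- covered.
    have h := measure_hitTime_le hP hX (Finset.range n) n (n + 1) (by simp)
      (f := barrier lam mu n (1 / M - 1) (mu 0 / M) ε) (fun j hj => barrier_of_lt hj _ _ _)
      (neg_one_le_barrier hlam hmu n hε.le fun j _ => ?_) (fun j hj => ?_) hε ?_
    · rw [barrier_of_le (Nat.zero_le n), scaleSum_zero] at h
      rw [zero_add]
      refine h.trans_eq ?_
      ring_nf
    · have h1 := mul_nonneg (div_nonneg hmu0 hM0.le) (scaleSum_nonneg hlam hmu j)
      have h2 : 0 < 1 / M := by positivity
      linarith
    · rcases (show n ≤ j by simpa using hj).eq_or_lt with rfl | hj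
      · rw [barrier_self, hself]
      · rw [barrier_of_lt hj]
    · intro i hi
      have hi : i < n := by simpa using hi
      cases i with
      | zero =>
        refine gen_barrier_zero hlam hmu hmu0 hi hε.le ?_
        field_simp
        ring
      | succ i => exact (gen_barrier_succ hlam hmu hi _ _ _ _).le
  rw [← zero_add (ENNReal.ofReal _)]
  refine ge_of_tendsto (tendsto_add_ofReal_mul 0 (1 / M) (meanTime lam mu n 0)) ?_
  filter_upwards [self_mem_nhdsWithin] with ε hε using key ε hε

theorem le_measure_hitTime_from_zero (hlam : ∀ i, 0 < lam i) (hmu : ∀ i, 1 ≤ i → 0 < mu i)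
    (hmu0 : 0 ≤ mu 0) (hP : IsTransitionFunction lam mu P) {n : ℕ}
    (hX : IsMarkovChainFrom P (st 0) X Pr) :
    ENNReal.ofReal (1 / (1 + mu 0 * scaleSum lam mu n)) ≤ Pr {ω | hitTime X n ω < ⊤} := by
  set M := 1 + mu 0 * scaleSum lam mu n with hM
  have hM1 : 1 ≤ M := by
    have := mul_nonneg hmu0 (scaleSum_nonneg hlam hmu n)
    linarith
  have hM0 : 0 < M := by linarith
  have key : ∀ ε : ℝ, 0 < ε → 1 ≤ Pr {ω | hitTime X n ω < ⊤} +
      ENNReal.ofReal (1 - 1 / M + ε * meanTime lam mu n 0) := by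
    intro ε hε
    -- The complementary weight `1 - (1 + μ₀ S_j) / M`, up to the `ε` term: `0` at `n` and `1` at
    -- `-1`. It is `1` above `n`, so jumping over `n` counts as a failure.
    have h := one_le_measure_hitTime_add hP hX (Finset.range n) n (n + 1) (fb := 0)
      (f := barrier lam mu n (-(1 / M)) (-(mu 0 / M)) ε) (fun j hj => barrier_of_lt hj _ _ _)
      le_rfl (neg_one_le_barrier hlam hmu n hε.le fun j hj => ?_) (fun j hj hjn => ?_) hε ?_
    · rw [barrier_of_le (Nat.zero_le n), scaleSum_zero] at h
      refine h.trans_eq ?_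
      ring_nf
    · have h1 : scaleSum lam mu j ≤ scaleSum lam mu n :=
        (scaleSum_strictMono hlam hmu).monotone hj
      have h2 : 1 / M + mu 0 / M * scaleSum lam mu j ≤ 1 := by
        rw [div_mul_eq_mul_div, ← add_div, div_le_one hM0, hM]
        gcongr
      linarith
    · rw [barrier_of_lt]
      have : n ≤ j := by simpa using hj
      omega
    · intro i hi
      have hi : i < n := by simpa using hi
      cases i with
      | zero =>
        refine gen_barrier_zero hlam hmu hmu0 hi hε.le ?_
        ring
      | succ i => exact (gen_barrier_succ hlam hmu hi _ _ _ _).le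
  have h1 : 1 ≤ Pr {ω | hitTime X n ω < ⊤} + ENNReal.ofReal (1 - 1 / M) := by
    refine ge_of_tendsto (tendsto_add_ofReal_mul _ (1 - 1 / M) (meanTime lam mu n 0)) ?_
    filter_upwards [self_mem_nhdsWithin] with ε hε using key ε hε
  have h2 : 1 / M ≤ 1 := by rwa [div_le_one hM0]
  calc ENNReal.ofReal (1 / M) = 1 - ENNReal.ofReal (1 - 1 / M) := by
        rw [← ENNReal.ofReal_one, ← ENNReal.ofReal_sub _ (by linarith)]
        ring_nf
    _ ≤ _ := tsub_le_iff_right.2 h1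

theorem le_measure_hitTime_zero_of_lt (hlam : ∀ i, 0 < lam i) (hmu : ∀ i, 1 ≤ i → 0 < mu i)
    (hP : IsTransitionFunction lam mu P) {n N : ℕ} (hN : n < N)
    (hX : IsMarkovChainFrom P (st n) X Pr) :
    1 - ENNReal.ofReal (scaleSum lam mu n) / ENNReal.ofReal (scaleSum lam mu N) ≤
      Pr {ω | hitTime X 0 ω < ⊤} := by
  have hSN : 0 < scaleSum lam mu N :=
    (scaleSum_nonneg hlam hmu n).trans_lt (scaleSum_strictMono hlam hmu hN)
  have key : ∀ ε : ℝ, 0 < ε → 1 ≤ Pr {ω | hitTime X 0 ω < ⊤} +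
      ENNReal.ofReal (scaleSum lam mu n / scaleSum lam mu N + ε * meanTime lam mu N n) := by
    intro ε hε
    have hself : -1 + 1 / scaleSum lam mu N * scaleSum lam mu N = 0 := by
      field_simp
      ring
    -- The weight is `S_j / S_N` plus the `ε` term, with value `1` from `N` on and at `∞`: reaching
    -- `N` before `0` is counted as a failure. The set `I` omits the target `0`, so killing at `0`
    -- plays no role.
    have h := one_le_measure_hitTime_add hP hX (Finset.Ico 1 N) 0 (N + 1) (fb := 0)
      (f := barrier lam mu N (-1) (1 / scaleSum lam mu N) ε)
      (fun j hj => barrier_of_lt hj _ _ _)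
      le_rfl (neg_one_le_barrier hlam hmu N hε.le fun j _ => ?_) (fun j hj hj0 => ?_) hε ?_
    · rw [barrier_of_le hN.le] at h
      refine h.trans_eq ?_
      ring_nf
    · have := mul_nonneg (one_div_pos.2 hSN).le (scaleSum_nonneg hlam hmu j)
      linarith
    · have : N ≤ j := by
        rw [Finset.mem_Ico] at hj
        omega
      rcases this.eq_or_lt with rfl | hj
      · rw [barrier_self, hself]
      · rw [barrier_of_lt hj]
    · intro i hi
      rw [Finset.mem_Ico] at hi
      obtain ⟨i, rfl⟩ := Nat.exists_eq_add_of_le' hi.1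
      exact (gen_barrier_succ hlam hmu hi.2 _ _ _ _).le
  rw [← ENNReal.ofReal_div_of_pos hSN]
  refine tsub_le_iff_right.2
    (ge_of_tendsto (tendsto_add_ofReal_mul _ _ (meanTime lam mu N n)) ?_)
  filter_upwards [self_mem_nhdsWithin] with ε hε using key ε hε

theorem tendsto_ofReal_scaleSum (hlam : ∀ i, 0 < lam i) (hmu : ∀ i, 1 ≤ i → 0 < mu i) :
    Tendsto (fun N => ENNReal.ofReal (scaleSum lam mu N)) atTop (𝓝 (LInf lam mu)) := by
  have h := ENNReal.tendsto_nat_tsum fun i => ENNReal.ofReal (lam i * piCoeff lam mu i)⁻¹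
  refine h.congr fun N => ?_
  rw [scaleSum, ENNReal.ofReal_sum_of_nonneg fun i _ => (inv_lam_mul_piCoeff_pos hlam hmu i).le]

theorem le_measure_hitTime_zero (hlam : ∀ i, 0 < lam i) (hmu : ∀ i, 1 ≤ i → 0 < mu i)
    (hP : IsTransitionFunction lam mu P) {n : ℕ}
    (hX : IsMarkovChainFrom P (st n) X Pr) :
    1 - ENNReal.ofReal (scaleSum lam mu n) / LInf lam mu ≤ Pr {ω | hitTime X 0 ω < ⊤} := by
  have h := ENNReal.Tendsto.sub (tendsto_const_nhds (x := (1 : ℝ≥0∞)))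
    (ENNReal.Tendsto.const_div (a := ENNReal.ofReal (scaleSum lam mu n))
      (tendsto_ofReal_scaleSum hlam hmu) (Or.inr ENNReal.ofReal_ne_top))
    (Or.inl ENNReal.one_ne_top)
  refine le_of_tendsto h ?_
  filter_upwards [eventually_gt_atTop n] with N hN
    using le_measure_hitTime_zero_of_lt hlam hmu hP hN hX

end HittingBounds

/-! ### The forward equation and the flux from infinity -/

section ForwardFlux

variable {lam mu : ℕ → ℝ} {P : ℝ → State → State → ℝ}

/-- Summation by parts for the forward equation, tested against a function `R` which is harmonic on
`{1, 2, …}`. -/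
theorem sum_q_right (x R : ℕ → ℝ)
    (hR : ∀ n, lam (n + 1) * (R (n + 1) - R (n + 2)) = mu (n + 1) * (R n - R (n + 1))) (M : ℕ) :
    ∑ j ∈ Finset.range (M + 1), (∑ k ∈ Finset.range (j + 2), x k * q lam mu k j) * R j =
      (lam 0 * (R 1 - R 0) - mu 0 * R 0) * x 0 +
        (mu (M + 1) * R M * x (M + 1) - lam M * R (M + 1) * x M) := by
  induction M with
  | zero =>
    simp [Finset.sum_range_succ, q]
    ring
  | succ M ih =>
    have h1 : ∑ k ∈ Finset.range (M + 1 + 2), x k * q lam mu k (M + 1) =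
        x M * lam M - x (M + 1) * (lam (M + 1) + mu (M + 1)) + x (M + 2) * mu (M + 2) := by
      rw [Finset.sum_range_succ, Finset.sum_range_succ, Finset.sum_range_succ, Finset.sum_eq_zero]
      · simp [q]
        ring
      · intro k hk
        have : k < M := by simpa using hk
        rw [q, if_neg (by omega), if_neg (by omega), if_neg (by omega), mul_zero]
    rw [Finset.sum_range_succ, ih, h1]
    linear_combination (-x (M + 1)) * hR M

theorem IsTransitionFunction.continuousOn (hP : IsTransitionFunction lam mu P) (i j : ℕ) :
    ContinuousOn (fun u => P u (st i) (st j)) (Set.Ici 0) :=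
  fun t ht => (hP.forward t ht i j).continuousWithinAt

theorem IsTransitionFunction.intervalIntegrable (hP : IsTransitionFunction lam mu P) {t : ℝ}
    (ht : 0 ≤ t) (i j : ℕ) : IntervalIntegrable (fun u => P u (st i) (st j)) volume 0 t :=
  ((hP.continuousOn i j).mono (by
    rw [Set.uIcc_of_le ht]
    exact Set.Icc_subset_Ici_self)).intervalIntegrable

theorem IsTransitionFunction.sum_st_le_one (hP : IsTransitionFunction lam mu P) {t : ℝ}
    (ht : 0 ≤ t) (x : State) (M : ℕ) : ∑ j ∈ Finset.range M, P t x (st j) ≤ 1 := by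
  have h := sum_le_hasSum ((Finset.range M).map ⟨st, st_injective⟩)
    (fun y _ => hP.nonneg t ht x y) (hP.hasSum_one t ht x)
  simpa using h

/-- The expected time spent in `j` up to time `t` when starting from `i`. -/
noncomputable def occupation (P : ℝ → State → State → ℝ) (t : ℝ) (i j : ℕ) : ℝ :=
  ∫ u in (0 : ℝ)..t, P u (st i) (st j)

theorem IsTransitionFunction.occupation_nonneg (hP : IsTransitionFunction lam mu P) {t : ℝ}
    (ht : 0 ≤ t) (i j : ℕ) : 0 ≤ occupation P t i j :=
  intervalIntegral.integral_nonneg ht fun u hu => hP.nonneg u hu.1 _ _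

theorem IsTransitionFunction.sum_occupation_le (hP : IsTransitionFunction lam mu P) {t : ℝ}
    (ht : 0 ≤ t) (i M : ℕ) : ∑ j ∈ Finset.range M, occupation P t i j ≤ t := by
  simp only [occupation]
  rw [← intervalIntegral.integral_finsetSum fun j _ => hP.intervalIntegrable ht i j]
  calc _ ≤ ∫ _ in (0 : ℝ)..t, (1 : ℝ) := by
        refine intervalIntegral.integral_mono_on ht
          ?_ (by simp) ?_
        · rw [← Finset.sum_fn]
          exact IntervalIntegrable.sum _ fun j _ => hP.intervalIntegrable ht i j
        · exact fun u hu => hP.sum_st_le_one hu.1 _ _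
    _ = t := by simp

/-- Integrating the forward equation for the states up to `M` against `R` leaves a boundary term at
`0`, of favourable sign by `hR0`, and the flux across the edge between `M` and `M + 1`. -/
theorem IsTransitionFunction.sum_mul_le_add_flux (hP : IsTransitionFunction lam mu P)
    {R : ℕ → ℝ}
    (hR : ∀ n, lam (n + 1) * (R (n + 1) - R (n + 2)) = mu (n + 1) * (R n - R (n + 1)))
    (hR0 : lam 0 * (R 1 - R 0) - mu 0 * R 0 ≤ 0) {t : ℝ} (ht : 0 ≤ t) {i M : ℕ} (hiM : i ≤ M) :
    ∑ j ∈ Finset.range (M + 1), P t (st i) (st j) * R j ≤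
      R i + (mu (M + 1) * R M * occupation P t i (M + 1) -
        lam M * R (M + 1) * occupation P t i M) := by
  set F : ℝ → ℝ := fun u => ∑ j ∈ Finset.range (M + 1), P u (st i) (st j) * R j with hF
  set G : ℝ → ℝ := fun u => (lam 0 * (R 1 - R 0) - mu 0 * R 0) * P u (st i) (st 0) +
        (mu (M + 1) * R M * P u (st i) (st (M + 1)) - lam M * R (M + 1) * P u (st i) (st M)) with hG
  have hd : ∀ u, 0 ≤ u → HasDerivWithinAt F (G u) (Set.Ici 0) u := by
    intro u hu
    have h := HasDerivWithinAt.fun_sum fun j (_ : j ∈ Finset.range (M + 1)) =>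
      (hP.forward u hu i j).mul_const (R j)
    rwa [sum_q_right (fun k => P u (st i) (st k)) R hR M] at h
  have hi := hP.intervalIntegrable ht i
  have hint2 : IntervalIntegrable (fun u => mu (M + 1) * R M * P u (st i) (st (M + 1)) -
      lam M * R (M + 1) * P u (st i) (st M)) volume 0 t :=
    ((hi (M + 1)).const_mul _).sub ((hi M).const_mul _)
  have hint : IntervalIntegrable G volume 0 t := ((hi 0).const_mul _).add hint2
  have hFTC : ∫ u in (0 : ℝ)..t, G u = F t - F 0 := by
    refine intervalIntegral.integral_eq_sub_of_hasDeriv_right_of_le ht ?_ ?_ hint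
    · exact fun u hu => (hd u hu.1).continuousWithinAt.mono Set.Icc_subset_Ici_self
    · exact fun u hu => (hd u hu.1.le).mono fun v hv => hu.1.le.trans (le_of_lt hv)
  have hF0 : F 0 = R i := by
    simp only [hF, hP.zero, st_inj, ite_mul, one_mul, zero_mul, Finset.sum_ite_eq,
      Finset.mem_range]
    rw [if_pos (by omega)]
  have hle : ∫ u in (0 : ℝ)..t, G u ≤ mu (M + 1) * R M * occupation P t i (M + 1) -
        lam M * R (M + 1) * occupation P t i M := by
    calc _ ≤ ∫ u in (0 : ℝ)..t, (mu (M + 1) * R M * P u (st i) (st (M + 1)) -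
          lam M * R (M + 1) * P u (st i) (st M)) := by
          refine intervalIntegral.integral_mono_on ht hint hint2 fun u hu => ?_
          have := mul_nonpos_of_nonpos_of_nonneg hR0 (hP.nonneg u hu.1 (st i) (st 0))
          simp only [hG]
          linarith
      _ = _ := by
          rw [intervalIntegral.integral_sub ((hi (M + 1)).const_mul _) ((hi M).const_mul _),
            intervalIntegral.integral_const_mul, intervalIntegral.integral_const_mul]
          rfl
  linarith

/-- The tail `∑_{k ≥ n} (λₖπₖ)⁻¹`. -/
noncomputable def scaleTail (lam mu : ℕ → ℝ) (n : ℕ) : ℝ :=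
  ∑' i, (lam i * piCoeff lam mu i)⁻¹ - scaleSum lam mu n

theorem scaleTail_sub_succ (n : ℕ) :
    scaleTail lam mu n - scaleTail lam mu (n + 1) = (lam n * piCoeff lam mu n)⁻¹ := by
  rw [scaleTail, scaleTail, scaleSum_succ]
  ring

theorem tendsto_scaleTail (hs : Summable fun i => (lam i * piCoeff lam mu i)⁻¹) :
    Tendsto (scaleTail lam mu) atTop (𝓝 0) := by
  have h := hs.hasSum.tendsto_sum_nat.const_sub (∑' i, (lam i * piCoeff lam mu i)⁻¹)
  rwa [sub_self] at h

theorem scaleTail_pos (hlam : ∀ i, 0 < lam i) (hmu : ∀ i, 1 ≤ i → 0 < mu i)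
    (hs : Summable fun i => (lam i * piCoeff lam mu i)⁻¹) (n : ℕ) : 0 < scaleTail lam mu n := by
  have h1 : scaleSum lam mu (n + 1) ≤ ∑' i, (lam i * piCoeff lam mu i)⁻¹ :=
    hs.sum_le_tsum _ fun i _ => (inv_lam_mul_piCoeff_pos hlam hmu i).le
  have h2 := scaleSum_strictMono hlam hmu (Nat.lt_succ_self n)
  rw [scaleTail]
  linarith

/-- Suppose that the mean of `R` has increased by `δ > 0`. The flux across every distant edge must
supply `δ`, which makes `(J n - δ) / R n` nondecreasing, where `J n` is the occupation time divided
by `πₙ`. As `R n → 0`, eventually `J n ≥ δ / 2`; but the occupation times have total at most `t`,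
whereas `∑ πₙ` diverges. -/
theorem IsTransitionFunction.sum_mul_scaleTail_le (hP : IsTransitionFunction lam mu P)
    (hlam : ∀ i, 0 < lam i) (hmu : ∀ i, 1 ≤ i → 0 < mu i) (hmu0 : 0 ≤ mu 0)
    (hs : Summable fun i => (lam i * piCoeff lam mu i)⁻¹)
    (hpi : ¬ Summable (piCoeff lam mu)) {t : ℝ} (ht : 0 ≤ t) (i M : ℕ) :
    ∑ j ∈ Finset.range M, P t (st i) (st j) * scaleTail lam mu j ≤ scaleTail lam mu i := by
  by_contra! hlt
  set R := scaleTail lam mu with hRdef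
  have hRpos : ∀ n, 0 < R n := scaleTail_pos hlam hmu hs
  have hRsub : ∀ n, R n - R (n + 1) = (lam n * piCoeff lam mu n)⁻¹ := scaleTail_sub_succ
  have hπ := piCoeff_pos hlam hmu
  set δ := ∑ j ∈ Finset.range M, P t (st i) (st j) * R j - R i with hδ
  have hδ0 : 0 < δ := sub_pos.2 hlt
  set J : ℕ → ℝ := fun n => occupation P t i n / piCoeff lam mu n with hJ
  have hJ0 : ∀ n, 0 ≤ J n := fun n => div_nonneg (hP.occupation_nonneg ht i n) (hπ n).le
  -- For `n ≥ M` the partial sums only grow, so the same `δ` is a lower bound for the flux; `n ≥ i`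
  -- ensures that the initial value `R i` is included.
  have hflux : ∀ n, max M i ≤ n → (J n - δ) / R n ≤ (J (n + 1) - δ) / R (n + 1) := by
    intro n hn
    have hMn : M ≤ n := (le_max_left _ _).trans hn
    have h1 := hP.sum_mul_le_add_flux (R := R)
      (fun k => by rw [hRsub (k + 1), hRsub k, lam_mul_inv_succ hlam hmu k]) ?_ ht
      ((le_max_right M i).trans hn)
    · have h2 : ∑ j ∈ Finset.range M, P t (st i) (st j) * R j ≤
          ∑ j ∈ Finset.range (n + 1), P t (st i) (st j) * R j :=
        Finset.sum_le_sum_of_subset_of_nonneg (Finset.range_mono (by omega))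
          fun j _ _ => mul_nonneg (hP.nonneg t ht _ _) (hRpos j).le
      have h3 : occupation P t i n = piCoeff lam mu n * J n :=
        (mul_div_cancel₀ _ (hπ n).ne').symm
      have h4 : occupation P t i (n + 1) = piCoeff lam mu (n + 1) * J (n + 1) :=
        (mul_div_cancel₀ _ (hπ (n + 1)).ne').symm
      have h5 := mu_mul_piCoeff_succ (lam := lam) hmu n
      have h6 : δ ≤ lam n * piCoeff lam mu n * (R n * J (n + 1) - R (n + 1) * J n) := by
        have : mu (n + 1) * R n * occupation P t i (n + 1) -
            lam n * R (n + 1) * occupation P t i n =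
            lam n * piCoeff lam mu n * (R n * J (n + 1) - R (n + 1) * J n) := by
          rw [h3, h4]
          linear_combination (R n * J (n + 1)) * h5
        linarith
      -- Dividing by `λₙπₙ` turns the factor of `δ` into the increment of `R`, so that `δ` can be
      -- absorbed into `J`.
      have h7 : δ * (R n - R (n + 1)) ≤ R n * J (n + 1) - R (n + 1) * J n := by
        rw [hRsub, ← div_eq_mul_inv, div_le_iff₀ (mul_pos (hlam n) (hπ n))]
        linarith
      rw [div_le_div_iff₀ (hRpos n) (hRpos (n + 1))]
      linarith
    · have h1 : R 1 ≤ R 0 := by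
        have := hRsub 0
        have := inv_lam_mul_piCoeff_pos hlam hmu 0
        linarith
      have h2 := mul_nonneg hmu0 (hRpos 0).le
      have h3 := mul_nonneg (hlam 0).le (sub_nonneg.2 h1)
      linarith
  set m := max M i
  have hbound : ∀ n, m ≤ n → -(δ / R m) ≤ (J n - δ) / R n := by
    intro n hn
    induction n, hn using Nat.le_induction with
    | base =>
      rw [← neg_div]
      have := hJ0 m
      have := hRpos m
      gcongr
      linarith
    | succ n hn ih => exact ih.trans (hflux n hn)
  have htend : Tendsto (fun n => δ / R m * R n) atTop (𝓝 0) := by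
    simpa using (tendsto_scaleTail hs).const_mul (δ / R m)
  obtain ⟨m', hm'⟩ := eventually_atTop.1
    ((htend.eventually (gt_mem_nhds (half_pos hδ0))).and (eventually_ge_atTop m))
  -- The bound `J n ≥ δ - (δ / R m) R n` has a right-hand side tending to `δ`; `m'` is chosen so
  -- that it exceeds `δ / 2`.
  have hocc : ∀ n, m' ≤ n → δ / 2 * piCoeff lam mu n ≤ occupation P t i n := by
    intro n hn
    obtain ⟨h1, h2⟩ := hm' n hn
    have h3 := hbound n h2
    rw [le_div_iff₀ (hRpos n)] at h3
    have h4 : δ / 2 ≤ J n := by linarith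
    exact (le_div_iff₀ (hπ n)).1 h4
  refine hpi ((summable_nat_add_iff m').1 (summable_of_sum_range_le
    (f := fun n => piCoeff lam mu (n + m')) (c := t / (δ / 2)) (fun n => (hπ _).le) fun n => ?_))
  rw [le_div_iff₀ (half_pos hδ0), Finset.sum_mul]
  calc _ ≤ ∑ k ∈ Finset.range n, occupation P t i (m' + k) := by
        refine Finset.sum_le_sum fun k _ => ?_
        rw [mul_comm, add_comm k]
        exact hocc _ (by omega)
    _ ≤ ∑ k ∈ Finset.range (m' + n), occupation P t i k := by
        rw [Finset.sum_range_add]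
        exact le_add_of_nonneg_left
          (Finset.sum_nonneg fun k _ => hP.occupation_nonneg ht i k)
    _ ≤ t := hP.sum_occupation_le ht i _

end ForwardFlux

/-! ### The upper bound for reaching `0` -/

section ReturnFromInfinity

variable {lam mu : ℕ → ℝ} {P : ℝ → State → State → ℝ} {Ω : Type*} [MeasurableSpace Ω]
  {X : ℝ≥0 → Ω → State} {Pr : Measure Ω}

/-- The weight `R_j / R_0`, extended by `0` to `-1` and `∞`, is superharmonic for `P t` at every `t
≥ 0`, so every skeleton obeys the bound and no slack term is needed. -/
theorem IsTransitionFunction.measure_hitTime_zero_le (hP : IsTransitionFunction lam mu P)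
    (hlam : ∀ i, 0 < lam i) (hmu : ∀ i, 1 ≤ i → 0 < mu i) (hmu0 : 0 ≤ mu 0)
    (hs : Summable fun i => (lam i * piCoeff lam mu i)⁻¹)
    (hpi : ¬ Summable (piCoeff lam mu)) {n : ℕ} (hX : IsMarkovChainFrom P (st n) X Pr) :
    Pr {ω | hitTime X 0 ω < ⊤} ≤ ENNReal.ofReal (scaleTail lam mu n / scaleTail lam mu 0) := by
  classical
  have hRpos := scaleTail_pos hlam hmu hs
  set v : ℕ → ℝ := fun j => scaleTail lam mu j / scaleTail lam mu 0 with hv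
  have hv0 : ∀ j, 0 ≤ v j := fun j => (div_pos (hRpos j) (hRpos 0)).le
  set w : State → ℝ≥0∞ := fun x => ∑' j, if x = st j then ENNReal.ofReal (v j) else 0 with hw
  have hwst : ∀ i, w (st i) = ENNReal.ofReal (v i) := fun i => by
    simp only [hw, st_inj]
    rw [tsum_eq_single i fun j hj => if_neg hj.symm, if_pos rfl]
  have hwsum : ∀ (t : ℝ) (x : State), ∑' y, ENNReal.ofReal (P t x y) * w y =
      ∑' j, ENNReal.ofReal (P t x (st j)) * ENNReal.ofReal (v j) := fun t x => by
    simp only [hw, ← ENNReal.tsum_mul_left]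
    rw [ENNReal.tsum_comm]
    refine tsum_congr fun j => ?_
    rw [tsum_eq_single (st j) fun y hy => by rw [if_neg hy, mul_zero], if_pos rfl]
  refine hX.measure_hit_le 0 (Eventually.of_forall fun k => ?_)
  have h := (hX.isDiscreteChain ((2 ^ k)⁻¹)).measure_hit_le {st 0} w (fun x _ => ?_) ?_
  · rw [hwst] at h
    exact h
  · have ht : (0 : ℝ) ≤ ((2 ^ k)⁻¹ : ℝ≥0) := NNReal.coe_nonneg _
    rw [hwsum]
    rcases state_cases x with rfl | rfl | ⟨i, rfl⟩
    · simp [hP.of_bot ht (st_ne_bot _), -NNReal.coe_inv]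
    · simp [hP.of_top ht (st_ne_top _), -NNReal.coe_inv]
    · rw [hwst, ENNReal.tsum_eq_iSup_nat]
      refine iSup_le fun M => ?_
      simp only [← ENNReal.ofReal_mul (hP.nonneg _ ht _ _)]
      rw [← ENNReal.ofReal_sum_of_nonneg fun j _ => mul_nonneg (hP.nonneg _ ht _ _) (hv0 j)]
      refine ENNReal.ofReal_le_ofReal ?_
      simp only [hv, ← mul_div_assoc]
      rw [← Finset.sum_div]
      exact div_le_div_of_nonneg_right
        (hP.sum_mul_scaleTail_le hlam hmu hmu0 hs hpi ht i M) (hRpos 0).le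
  · rintro _ rfl
    simp [hwst, hv, div_self (hRpos 0).ne']

/-- Both series are dominated termwise by the one for `L_∞ K_∞`. -/
theorem C_add_D_ne_top (hlam : ∀ i, 0 < lam i) (hmu : ∀ i, 1 ≤ i → 0 < mu i)
    (hL : LInf lam mu ≠ ⊤) (hK : KInf lam mu ≠ ⊤) : C lam mu + D lam mu ≠ ⊤ := by
  have hKn : ∀ n, ENNReal.ofReal (K lam mu n) ≤ KInf lam mu := fun n => by
    rw [K, ENNReal.ofReal_sum_of_nonneg fun i _ => (piCoeff_pos hlam hmu i).le]
    exact ENNReal.sum_le_tsum _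
  have hLK := ENNReal.mul_ne_top hL hK
  rw [LInf, ← ENNReal.tsum_mul_right] at hLK
  refine ENNReal.add_ne_top.2 ⟨ne_top_of_le_ne_top hLK ?_, ne_top_of_le_ne_top hLK ?_⟩
  · exact ENNReal.tsum_le_tsum fun n => by gcongr; exact hKn n
  · exact ENNReal.tsum_le_tsum fun n => by gcongr; exact tsub_le_self

end ReturnFromInfinity

end BirthDeath

/-! ### The two hitting probabilities -/

open BirthDeath in
theorem corollary1 (lam mu : ℕ → ℝ) (hlam : ∀ i, 0 < lam i) (hmu : ∀ i, 1 ≤ i → 0 < mu i)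
    (hmu0 : 0 ≤ mu 0) (P : ℝ → State → State → ℝ) (hP : IsTransitionFunction lam mu P)
    {Ω : Type*} [MeasurableSpace Ω] (n : ℕ) (hn : 1 ≤ n) :
    (∀ (Pr : Measure Ω) (X : ℝ≥0 → Ω → State), IsMarkovChainFrom P (st 0) X Pr →
      Pr {ω | hitTime X n ω < ⊤} = ENNReal.ofReal (1 / (1 + mu 0 * L lam mu (n - 1)))) ∧
    (C lam mu + D lam mu = ⊤ →
      ∀ (Pr : Measure Ω) (X : ℝ≥0 → Ω → State), IsMarkovChainFrom P (st n) X Pr →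
        Pr {ω | hitTime X 0 ω < ⊤} =
          1 - ENNReal.ofReal (L lam mu (n - 1)) / LInf lam mu) := by
  rw [L_pred hn]
  refine ⟨fun Pr X hX => le_antisymm (measure_hitTime_from_zero_le hlam hmu hmu0 hP hX)
    (le_measure_hitTime_from_zero hlam hmu hmu0 hP hX), fun hCD Pr X hX =>
    le_antisymm ?_ (le_measure_hitTime_zero hlam hmu hP hX)⟩
  have hprob := hX.isProbabilityMeasure
  by_cases hL : LInf lam mu = ⊤
  · rw [hL, ENNReal.div_top, tsub_zero]
    exact prob_le_one
  -- The only use of `C + D = ∞`: with `L_∞` finite it makes `∑ πₙ` diverge, as the flux argument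
  -- requires.
  have hK : KInf lam mu = ⊤ := by
    by_contra hK
    exact C_add_D_ne_top hlam hmu hL hK hCD
  have hnn := fun i => (inv_lam_mul_piCoeff_pos hlam hmu i).le
  have hs : Summable fun i => (lam i * piCoeff lam mu i)⁻¹ := by
    refine (ENNReal.summable_toReal hL).congr fun i => ?_
    rw [ENNReal.toReal_ofReal (hnn i)]
  have hpi : ¬ Summable (piCoeff lam mu) := fun h => h.tsum_ofReal_ne_top hK
  have hR0 := scaleTail_pos hlam hmu hs 0
  refine (hP.measure_hitTime_zero_le hlam hmu hmu0 hs hpi hX).trans_eq ?_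
  have h0 : scaleTail lam mu 0 = ∑' i, (lam i * piCoeff lam mu i)⁻¹ := by
    rw [scaleTail, scaleSum_zero, sub_zero]
  have h1 : scaleTail lam mu n = scaleTail lam mu 0 - scaleSum lam mu n := by
    rw [h0, scaleTail]
  rw [LInf, ← ENNReal.ofReal_tsum_of_nonneg hnn hs, ← h0, ← ENNReal.ofReal_div_of_pos hR0,
    ← ENNReal.ofReal_one, ← ENNReal.ofReal_sub _ (div_nonneg (scaleSum_nonneg hlam hmu n) hR0.le),
    h1, sub_div, div_self hR0.ne']
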